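/- Let $r>0$, $\nu>0$ and $0<p<1$, and let $X$ be an $\mathbb N_0$-valued random variable following the COM-negative binomial distribution $\mathrm{CMNB}(r,\nu,p)$, that is, $$\mathrm P(X=k)=\frac{\left(\frac{\Gamma(r+k)}{k!\,\Gamma(r)}\right)^{\nu}p^k(1-p)^r}{\sum_{i=0}^\infty\left(\frac{\Gamma(r+i)}{i!\,\Gamma(r)}\right)^{\nu}p^i(1-p)^r},\qquad k=0,1,2,\dots$$ If either $r\le 1$, or $r>1$ and $p\,r^{\nu}<1$, then $X$ is discrete pseudo compound Poisson distributed: there exist $\lambda>0$ and real numbers $\alpha_1,\alpha_2,\dots$ with $\sum_{i=1}^\infty|\alpha_i|<\infty$ and $\sum_{i=1}^\infty\alpha_i=1$ such that the probability generating function of $X$ satisfies $$\sum_{k=0}^\infty \mathrm P(X=k)\,z^k=\exp\left\{\sum_{i=1}^\infty\alpha_i\lambda(z^i-1)\right\}\qquad\text{for all complex } z \text{ with } |z|\le 1.$$ -/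

import Mathlib

open MeasureTheory

noncomputable section

/-- The unnormalized weight `(Γ(r+k) / (k! Γ(r)))^ν * p^k * (1-p)^r` of the COM-negative binomial
distribution with parameters `(r, ν, p)`. -/
def cmnbWeight (r ν p : ℝ) (k : ℕ) : ℝ :=
  (Real.Gamma (r + k) / (k.factorial * Real.Gamma r)) ^ ν * p ^ k * (1 - p) ^ r

/-- The normalization constant `C(r, ν, p)`. -/
def cmnbConst (r ν p : ℝ) : ℝ := ∑' i : ℕ, cmnbWeight r ν p i

/-- The probability mass function of the COM-negative binomial distribution `CMNB(r, ν, p)`. -/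
def cmnbMass (r ν p : ℝ) (k : ℕ) : ℝ := cmnbWeight r ν p k / cmnbConst r ν p

theorem cmnbWeight_pos {r ν p : ℝ} (hr : 0 < r) (hp0 : 0 < p) (hp1 : p < 1) (k : ℕ) :
    0 < cmnbWeight r ν p k := by
  have h1 : 0 < Real.Gamma (r + k) := Real.Gamma_pos_of_pos (by positivity)
  have h2 : 0 < Real.Gamma r := Real.Gamma_pos_of_pos hr
  have h3 : 0 < 1 - p := by linarith
  unfold cmnbWeight
  positivity

theorem cmnbWeight_succ {r ν p : ℝ} (hr : 0 < r) (k : ℕ) :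
    cmnbWeight r ν p (k + 1) = p * ((k + r) / (k + 1)) ^ ν * cmnbWeight r ν p k := by
  have h1 : 0 < Real.Gamma (r + k) := Real.Gamma_pos_of_pos (by positivity)
  have h2 : 0 < Real.Gamma r := Real.Gamma_pos_of_pos hr
  have h3 : Real.Gamma (r + (k + 1 : ℕ)) = (r + k) * Real.Gamma (r + k) := by
    rw [← Real.Gamma_add_one (by positivity)]
    push_cast
    congr 1
    ring
  have h4 : Real.Gamma (r + (k + 1 : ℕ)) / ((k + 1).factorial * Real.Gamma r)
      = ((k + r) / (k + 1)) * (Real.Gamma (r + k) / (k.factorial * Real.Gamma r)) := by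
    rw [h3, Nat.factorial_succ]
    push_cast
    field_simp
    ring
  unfold cmnbWeight
  rw [h4, Real.mul_rpow (by positivity) (by positivity)]
  ring

/-- The series defining the normalization constant converges. -/
theorem cmnbWeight_summable {r ν p : ℝ} (hr : 0 < r) (hν : 0 < ν) (hp0 : 0 < p) (hp1 : p < 1) :
    Summable (cmnbWeight r ν p) := by
  refine summable_of_ratio_test_tendsto_lt_one hp1
    (Filter.Eventually.of_forall fun k => (cmnbWeight_pos hr hp0 hp1 k).ne') ?_
  have h1 : Filter.Tendsto (fun k : ℕ => ((k : ℝ) + r) / (k + 1)) Filter.atTop (nhds 1) := by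
    have h := (tendsto_one_div_add_atTop_nhds_zero_nat (𝕜 := ℝ)).const_mul (r - 1)
    have h' := h.const_add 1
    simp only [mul_zero, add_zero] at h'
    refine h'.congr fun k => ?_
    field_simp
    ring
  have h2 : Filter.Tendsto (fun k : ℕ => p * (((k : ℝ) + r) / (k + 1)) ^ ν)
      Filter.atTop (nhds p) := by
    have h := (h1.rpow_const (p := ν) (Or.inr hν.le)).const_mul p
    simpa using h
  refine h2.congr fun k => ?_
  have hk := cmnbWeight_pos (ν := ν) hr hp0 hp1 k
  have hk' := cmnbWeight_pos (ν := ν) hr hp0 hp1 (k + 1)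
  rw [Real.norm_of_nonneg hk.le, Real.norm_of_nonneg hk'.le, cmnbWeight_succ hr,
    mul_div_assoc, div_self hk.ne', mul_one]

/-- The masses of `CMNB(r, ν, p)` add up to one. -/
theorem cmnbMass_hasSum {r ν p : ℝ} (hr : 0 < r) (hν : 0 < ν) (hp0 : 0 < p) (hp1 : p < 1) :
    HasSum (cmnbMass r ν p) 1 := by
  have hs := cmnbWeight_summable hr hν hp0 hp1
  have hC : 0 < cmnbConst r ν p :=
    hs.tsum_pos (fun k => (cmnbWeight_pos hr hp0 hp1 k).le) 0 (cmnbWeight_pos hr hp0 hp1 0)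
  have h := hs.hasSum.div_const (cmnbConst r ν p)
  rwa [show ∑' i, cmnbWeight r ν p i = cmnbConst r ν p from rfl, div_self hC.ne'] at h

/-- The random variable `X` follows the distribution `CMNB(r, ν, p)`. -/
def IsCMNB {Ω : Type*} [MeasurableSpace Ω] (P : Measure Ω) (X : Ω → ℕ) (r ν p : ℝ) : Prop :=
  ∀ k : ℕ, P.real {ω | X ω = k} = cmnbMass r ν p k

/-- The probability generating function `G(z) = ∑ P(X = k) z^k`, at complex `z`. -/
def pgf {Ω : Type*} [MeasurableSpace Ω] (P : Measure Ω) (X : Ω → ℕ) (z : ℂ) : ℂ :=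
  ∑' k : ℕ, (P.real {ω | X ω = k} : ℂ) * z ^ k

/-- The random variable `X` follows a discrete pseudo compound Poisson distribution: on the closed
unit disc, `G(z) = exp (∑_{i ≥ 1} α_i λ (z^i - 1))`, where `λ > 0` and the real numbers `α_i` are
absolutely summable with sum one. Here `a i` stands for `α_{i+1}`. -/
def IsDPCP {Ω : Type*} [MeasurableSpace Ω] (P : Measure Ω) (X : Ω → ℕ) : Prop :=
  ∃ (a : ℕ → ℝ) (lam : ℝ), 0 < lam ∧ Summable (fun i => |a i|) ∧ HasSum a 1 ∧
    ∀ z : ℂ, ‖z‖ ≤ 1 →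
      pgf P X z = Complex.exp (∑' i : ℕ, (a i : ℂ) * (lam : ℂ) * (z ^ (i + 1) - 1))

end

/-! Consecutive masses have ratio `p * ((k + r) / (k + 1)) ^ ν`, and either case hypothesis bounds
it by some `q < 1`. For such coefficients `(1 - q z) G(z)` has positive real part on a disc of
radius `R > 1` (`re_one_sub_mul_tsum_pos`), so `G` has no zero there and has a holomorphic logarithm
`∑ h n z ^ n` with real coefficients, absolutely convergent at `z = 1` (`exists_tsum_eq_exp_tsum`).
Since `G(1) = 1`, the `h n` sum to zero, so `λ = -h 0` and `α_i = h i / λ` give the required form.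
-/

open ComplexConjugate in
/-- A complex function that is holomorphic on a disc and commutes with conjugation is the sum of a
power series with real coefficients. -/
theorem exists_real_hasSum_of_differentiableOn {H : ℂ → ℂ} {R : ℝ}
    (hH : DifferentiableOn ℂ H (Metric.ball 0 R))
    (hconj : ∀ z ∈ Metric.ball (0 : ℂ) R, H (conj z) = conj (H z)) :
    ∃ h : ℕ → ℝ, ∀ z ∈ Metric.ball (0 : ℂ) R, HasSum (fun n => (h n : ℂ) * z ^ n) (H z) := by
  set c : ℕ → ℂ := fun n => (n.factorial : ℂ)⁻¹ * iteratedDeriv n H 0 with hc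
  have hs : ∀ z ∈ Metric.ball (0 : ℂ) R, HasSum (fun n => c n * z ^ n) (H z) := fun z hz => by
    convert Complex.hasSum_taylorSeries_on_ball hH hz using 1
    · rfl
    · funext n
      simp only [hc, smul_eq_mul, sub_zero]
      ring
  refine ⟨fun n => (c n).re, fun z hz => ?_⟩
  have hz' : conj z ∈ Metric.ball (0 : ℂ) R := by
    simpa [mem_ball_zero_iff] using hz
  -- Conjugating the series at `conj z` gives a second expansion of `H z`, with conjugate
  -- coefficients; averaging the two leaves the real parts.
  have h2 := (hs _ hz').map (starRingEnd ℂ) Complex.continuous_conj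
  rw [hconj z hz] at h2
  have h3 := ((hs z hz).add h2).div_const 2
  convert h3 using 1
  · rfl
  · funext n
    rw [Function.comp_apply, map_mul, map_pow, Complex.conj_conj, Complex.re_eq_add_conj]
    ring
  · rw [Complex.conj_conj]
    ring

section GeometricRatio

variable {w : ℕ → ℝ} {q : ℝ}

theorem le_mul_pow_of_succ_le (hq : 0 < q) (hw : ∀ k, w (k + 1) ≤ q * w k) (k : ℕ) :
    w k ≤ w 0 * q ^ k := by
  induction k with
  | zero => simp
  | succ k ih =>
    calc w (k + 1) ≤ q * w k := hw k
      _ ≤ q * (w 0 * q ^ k) := by gcongr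
      _ = w 0 * q ^ (k + 1) := by ring

theorem norm_coeff_mul_pow_le (hpos : ∀ k, 0 < w k) (hq : 0 < q)
    (hw : ∀ k, w (k + 1) ≤ q * w k) {R : ℝ} {z : ℂ} (hz : ‖z‖ ≤ R) (k : ℕ) :
    ‖(w k : ℂ) * z ^ k‖ ≤ w 0 * (q * R) ^ k := by
  rw [norm_mul, norm_pow, Complex.norm_of_nonneg (hpos k).le, mul_pow, ← mul_assoc]
  have := hpos 0
  gcongr
  exact le_mul_pow_of_succ_le hq hw k

theorem summable_coeff_mul_pow (hpos : ∀ k, 0 < w k) (hq : 0 < q)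
    (hw : ∀ k, w (k + 1) ≤ q * w k) {R : ℝ} (hqR : q * R < 1) {z : ℂ} (hz : ‖z‖ ≤ R) :
    Summable fun k => (w k : ℂ) * z ^ k := by
  have hR : 0 ≤ R := (norm_nonneg z).trans hz
  exact .of_norm_bounded ((summable_geometric_of_lt_one (by positivity) hqR).mul_left (w 0))
    (norm_coeff_mul_pow_le hpos hq hw hz)

/-- The coefficients on the left are nonnegative by `hw`, so the norm of the sum is largest at `z =
R`. -/
theorem hasSum_one_sub_mul_tsum (hpos : ∀ k, 0 < w k) (hq : 0 < q)
    (hw : ∀ k, w (k + 1) ≤ q * w k) {R : ℝ} (hqR : q * R < 1) {z : ℂ} (hz : ‖z‖ ≤ R) :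
    HasSum (fun k => ((q * w k - w (k + 1) : ℝ) : ℂ) * z ^ (k + 1))
      (w 0 - (1 - q * z) * ∑' k, (w k : ℂ) * z ^ k) := by
  have hs := (summable_coeff_mul_pow hpos hq hw hqR hz).hasSum
  have h1 := (hasSum_nat_add_iff' 1).mpr hs
  have h2 := (hs.mul_left (q * z)).sub h1
  convert h2 using 1
  · rfl
  · funext k
    push_cast
    ring
  · simp only [Finset.sum_range_one, pow_zero, mul_one]
    ring

/-- An Eneström–Kakeya estimate: if the coefficients of a power series decrease at least
geometrically with ratio `q`, then the series times `1 - q z` has positive real part. -/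
theorem re_one_sub_mul_tsum_pos (hpos : ∀ k, 0 < w k) (hq : 0 < q)
    (hw : ∀ k, w (k + 1) ≤ q * w k) {R : ℝ} (hqR : q * R < 1) {z : ℂ} (hz : ‖z‖ ≤ R) :
    0 < ((1 - q * z) * ∑' k, (w k : ℂ) * z ^ k).re := by
  have hR : 0 ≤ R := (norm_nonneg z).trans hz
  have hRn : ‖(R : ℂ)‖ ≤ R := (Complex.norm_of_nonneg hR).le
  have hz1 := hasSum_one_sub_mul_tsum hpos hq hw hqR hz
  have hsR : Summable fun k => w k * R ^ k := by
    have := summable_coeff_mul_pow hpos hq hw hqR hRn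
    exact_mod_cast this
  have hR1 : HasSum (fun k => (q * w k - w (k + 1)) * R ^ (k + 1))
      (w 0 - (1 - q * R) * ∑' k, w k * R ^ k) := by
    have := hasSum_one_sub_mul_tsum hpos hq hw hqR hRn
    exact_mod_cast this
  -- With `f` the series, `|w 0 - (1 - q z) f(z)| ≤ w 0 - (1 - q R) f(R) < w 0`, which keeps `(1 - q
  -- z) f(z)` in the right half-plane.
  have hle := tsum_of_norm_bounded (f := fun k => ((q * w k - w (k + 1) : ℝ) : ℂ) * z ^ (k + 1))
    hR1 fun k => by
      rw [norm_mul, norm_pow, Complex.norm_of_nonneg (sub_nonneg.mpr (hw k))]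
      have := sub_nonneg.mpr (hw k)
      gcongr
  rw [hz1.tsum_eq] at hle
  have hfR : 0 < ∑' k, w k * R ^ k :=
    hsR.tsum_pos (fun k => mul_nonneg (hpos k).le (pow_nonneg hR k)) 0 (by simpa using hpos 0)
  have hre := (Complex.re_le_norm _).trans hle
  rw [Complex.sub_re, Complex.ofReal_re] at hre
  have := mul_pos (sub_pos.mpr hqR) hfR
  linarith

open ComplexConjugate in
/-- A power series with positive coefficients that decrease at least geometrically is, on the
closed unit disc, the exponential of an absolutely convergent real power series. -/
theorem exists_tsum_eq_exp_tsum (hpos : ∀ k, 0 < w k) (hq : 0 < q) (hq1 : q < 1)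
    (hw : ∀ k, w (k + 1) ≤ q * w k) :
    ∃ h : ℕ → ℝ, Summable (fun n => |h n|) ∧ ∀ z : ℂ, ‖z‖ ≤ 1 →
      ∑' k, (w k : ℂ) * z ^ k = Complex.exp (∑' n, (h n : ℂ) * z ^ n) := by
  obtain ⟨R, hR1, hR⟩ := exists_between ((one_lt_inv₀ hq).mpr hq1)
  have hqR : q * R < 1 := by rwa [lt_inv_comm₀ (by linarith) hq, ← one_div,
    lt_div_iff₀ (by linarith)] at hR
  set f : ℂ → ℂ := fun z => ∑' k, (w k : ℂ) * z ^ k with hf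
  have hle : ∀ z ∈ Metric.ball (0 : ℂ) R, ‖z‖ ≤ R := fun z hz =>
    (mem_ball_zero_iff.mp hz).le
  have hre : ∀ z ∈ Metric.ball (0 : ℂ) R, 0 < ((1 - q * z) * f z).re := fun z hz =>
    re_one_sub_mul_tsum_pos hpos hq hw hqR (hle z hz)
  have hre' : ∀ z ∈ Metric.ball (0 : ℂ) R, 0 < (1 - q * z).re := fun z hz => by
    have h1 := (Complex.re_le_norm z).trans (hle z hz)
    simp only [Complex.sub_re, Complex.one_re, Complex.re_ofReal_mul]
    nlinarith
  have hfd : DifferentiableOn ℂ f (Metric.ball 0 R) :=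
    Complex.differentiableOn_tsum_of_summable_norm
      ((summable_geometric_of_lt_one (by positivity) hqR).mul_left (w 0))
      (fun k => by fun_prop) Metric.isOpen_ball
      fun k z hz => norm_coeff_mul_pow_le hpos hq hw (hle z hz) k
  have hfconj : ∀ z, f (conj z) = conj (f z) := fun z => by
    simp [hf, Complex.conj_tsum]
  -- Both arguments lie in the right half-plane, where the principal logarithm is holomorphic; `f z`
  -- itself need not.
  set H : ℂ → ℂ := fun z => Complex.log ((1 - q * z) * f z) - Complex.log (1 - q * z) with hH
  have hHd : DifferentiableOn ℂ H (Metric.ball 0 R) :=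
    (DifferentiableOn.clog (DifferentiableOn.mul (by fun_prop) hfd)
      fun z hz => Or.inl (hre z hz)).sub
      (DifferentiableOn.clog (by fun_prop) fun z hz => Or.inl (hre' z hz))
  have harg : ∀ u : ℂ, 0 < u.re → Complex.log (conj u) = conj (Complex.log u) := fun u hu =>
    Complex.log_conj _ (Complex.slitPlane_arg_ne_pi (Or.inl hu))
  obtain ⟨h, hh⟩ := exists_real_hasSum_of_differentiableOn hHd fun z hz => by
    simp only [hH]
    rw [map_sub, ← harg _ (hre z hz), ← harg _ (hre' z hz), hfconj]
    simp
  refine ⟨h, ?_, fun z hz => ?_⟩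
  -- As `R > 1`, the point `1` is interior to the disc of convergence.
  · have h1 := (hh 1 (by simpa using hR1)).summable.norm
    simpa using h1
  · have hzb : z ∈ Metric.ball (0 : ℂ) R := by
      rw [mem_ball_zero_iff]; linarith
    have hne : ∀ u : ℂ, 0 < u.re → u ≠ 0 := fun u hu h0 => by simp [h0] at hu
    have hn2 := hne _ (hre' z hzb)
    rw [(hh z hzb).tsum_eq, Complex.exp_sub, Complex.exp_log (hne _ (hre z hzb)),
      Complex.exp_log hn2, mul_div_cancel_left₀ _ hn2]

end GeometricRatio

/-- A probability mass function on `ℕ` with positive masses that decrease at least geometrically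
is discrete pseudo compound Poisson. -/
theorem isDPCP_of_succ_le {Ω : Type*} [MeasurableSpace Ω] {P : Measure Ω} {X : Ω → ℕ}
    {w : ℕ → ℝ} {q : ℝ} (hX : ∀ k, P.real {ω | X ω = k} = w k) (hsum : HasSum w 1)
    (hpos : ∀ k, 0 < w k) (hq : 0 < q) (hq1 : q < 1) (hw : ∀ k, w (k + 1) ≤ q * w k) :
    IsDPCP P X := by
  obtain ⟨h, habs, hexp⟩ := exists_tsum_eq_exp_tsum hpos hq hq1 hw
  have hs : Summable h := habs.of_abs
  have hs1 : Summable fun i => h (i + 1) := (summable_nat_add_iff 1).mpr hs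
  have htot : ∑' n, h n = 0 := by
    have h1 := hexp 1 (by simp)
    simp only [one_pow, mul_one] at h1
    rw [← Complex.ofReal_tsum, ← Complex.ofReal_tsum, hsum.tsum_eq, ← Complex.ofReal_exp,
      Complex.ofReal_inj] at h1
    exact Real.exp_eq_one_iff _ |>.mp h1.symm
  have hzero : w 0 = Real.exp (h 0) := by
    have h1 := hexp 0 (by simp)
    rw [tsum_eq_single 0 (fun n hn => by simp [hn]), tsum_eq_single 0 (fun n hn => by simp [hn])]
      at h1
    simp only [pow_zero, mul_one] at h1
    exact_mod_cast h1
  -- Strict because `w 1 > 0`; this is what makes `λ = -h 0` positive.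
  have hw0 : w 0 < 1 := by
    have h1 := hsum.summable.sum_le_tsum (Finset.range 2) (fun k _ => (hpos k).le)
    rw [hsum.tsum_eq, Finset.sum_range_succ, Finset.sum_range_one] at h1
    linarith [hpos 1]
  have hneg : h 0 < 0 := by rwa [hzero, Real.exp_lt_one_iff] at hw0
  have htail : ∑' i, h (i + 1) = -h 0 := by
    have := hs.tsum_eq_zero_add
    linarith
  refine ⟨fun i => h (i + 1) / -h 0, -h 0, neg_pos.mpr hneg, ?_, ?_, fun z hz => ?_⟩
  · simp only [abs_div]
    exact ((summable_nat_add_iff 1).mpr habs).div_const _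
  · have h1 := hs1.hasSum.div_const (-h 0)
    rwa [htail, div_self (neg_pos.mpr hneg).ne'] at h1
  · have hsz : Summable fun n => (h n : ℂ) * z ^ n := by
      refine .of_norm_bounded habs fun n => ?_
      rw [norm_mul, norm_pow, Complex.norm_real, Real.norm_eq_abs]
      exact mul_le_of_le_one_right (abs_nonneg _) (pow_le_one₀ (norm_nonneg z) hz)
    have hsz1 : Summable fun i => (h (i + 1) : ℂ) * z ^ (i + 1) := (summable_nat_add_iff 1).mpr hsz
    have hsc : Summable fun i => (h (i + 1) : ℂ) := Complex.summable_ofReal.mpr hs1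
    have hne : (h 0 : ℂ) ≠ 0 := Complex.ofReal_ne_zero.mpr hneg.ne
    have hterm : ∀ i : ℕ, ((h (i + 1) / -h 0 : ℝ) : ℂ) * ((-h 0 : ℝ) : ℂ) * (z ^ (i + 1) - 1)
        = (h (i + 1) : ℂ) * z ^ (i + 1) - h (i + 1) := fun i => by
      push_cast
      field_simp
    simp only [pgf, hX]
    rw [hexp z hz, tsum_congr hterm, hsz1.tsum_sub hsc, ← Complex.ofReal_tsum, htail,
      hsz.tsum_eq_zero_add]
    congr 1
    push_cast
    ring

theorem cmnbMass_succ_le {r ν p q : ℝ} (hr : 0 < r) (hp0 : 0 < p) (hp1 : p < 1)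
    (hq : ∀ k : ℕ, p * (((k : ℝ) + r) / (k + 1)) ^ ν ≤ q) (k : ℕ) :
    cmnbMass r ν p (k + 1) ≤ q * cmnbMass r ν p k := by
  have hC : 0 ≤ cmnbConst r ν p := tsum_nonneg fun k => (cmnbWeight_pos hr hp0 hp1 k).le
  have hk := (cmnbWeight_pos (ν := ν) hr hp0 hp1 k).le
  unfold cmnbMass
  rw [cmnbWeight_succ hr, ← mul_div_assoc]
  gcongr
  exact hq k

theorem cmnbMass_pos {r ν p : ℝ} (hr : 0 < r) (hν : 0 < ν) (hp0 : 0 < p) (hp1 : p < 1) (k : ℕ) :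
    0 < cmnbMass r ν p k :=
  div_pos (cmnbWeight_pos hr hp0 hp1 k) <|
    (cmnbWeight_summable hr hν hp0 hp1).tsum_pos (fun k => (cmnbWeight_pos hr hp0 hp1 k).le) 0
      (cmnbWeight_pos hr hp0 hp1 0)

theorem mainTheorem5 {Ω : Type*} [MeasurableSpace Ω] (P : Measure Ω) [IsProbabilityMeasure P]
    (X : Ω → ℕ) (hX : Measurable X) (r ν p : ℝ) (hr : 0 < r) (hν : 0 < ν)
    (hp0 : 0 < p) (hp1 : p < 1) (hlaw : IsCMNB P X r ν p)
    (hcase : (p * r ^ ν < 1 ∧ 1 < r) ∨ r ≤ 1) :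
    IsDPCP P X := by
  obtain ⟨q, hq, hq1, hle⟩ : ∃ q : ℝ, 0 < q ∧ q < 1 ∧
      ∀ k : ℕ, p * (((k : ℝ) + r) / (k + 1)) ^ ν ≤ q := by
    rcases hcase with ⟨hpr, hr1⟩ | hr1
    -- For `r > 1` the ratio `(k + r) / (k + 1)` is largest at `k = 0`, with value `r`.
    · refine ⟨p * r ^ ν, by positivity, hpr, fun k => ?_⟩
      gcongr
      rw [div_le_iff₀ (by positivity)]
      nlinarith [mul_nonneg (sub_nonneg.mpr hr1.le) (Nat.cast_nonneg (α := ℝ) k)]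
    · refine ⟨p, hp0, hp1, fun k => mul_le_of_le_one_right hp0.le ?_⟩
      refine Real.rpow_le_one (by positivity) ?_ hν.le
      rw [div_le_one (by positivity)]
      linarith
  exact isDPCP_of_succ_le hlaw (cmnbMass_hasSum hr hν hp0 hp1) (cmnbMass_pos hr hν hp0 hp1)
    hq hq1 (cmnbMass_succ_le hr hp0 hp1 hle)
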